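/- Let $\mathscr P(\mathbb R^d)$ be the set of Borel probability measures on $\mathbb R^d$, and $I(\mathbb R^d)$ the set of infinitely divisible ones. Write $\widehat\mu(z)$ for the characteristic function of $\mu$. For $\mu\in I(\mathbb R^d)$ let $C_\mu$ be the unique continuous function with $C_\mu(0)=0$ and $\widehat\mu=e^{C_\mu}$. For $t>0$ put $\widehat\mu(z)^t:=e^{tC_\mu(z)}$, and let the $t$-th convolution of $\mu$ be the distribution with this characteristic function. A set $H\subset I(\mathbb R^d)$ is called completely closed in the strong sense (c.c.s.s.) if it is closed under convolution, under weak convergence, under type equivalence (if $X$ has its law in $H$, then so has $aX+c$ for all $a>0$ and $c\in\mathbb R^d$), and under $t$-th convolution for every $t>0$. Let $\alpha\in\mathbb R$. Say that $\mu\in\mathscr P(\mathbb R^d)$ is an $\alpha$-limit of a sequence $(\mu_j)_{j\ge1}$ in $I(\mathbb R^d)$ if there exist $a_n>0$ nondecreasing with $a_n\to\infty$ and $a_{n+1}/a_n\to1$, $c_n\in\mathbb R^d$, and $p_n>0$ with $p_n/a_n^\alpha\to1$, such that $$\lim_{n\to\infty}\prod_{j=1}^n\widehat\mu_j(a_n^{-1}z)^{p_n}\,e^{i\langle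 c_n,z\rangle}=\widehat\mu(z)\qquad\text{for all }z\in\mathbb R^d.$$ For $H\subset I(\mathbb R^d)$, let $\mathfrak Q_\alpha(H)$ be the set of all $\mu\in\mathscr P(\mathbb R^d)$ that are an $\alpha$-limit of some sequence $(\mu_j)_{j\ge1}$ in $I(\mathbb R^d)$ such that, for some $j_0\ge1$, $\mu_j\in H$ for all $j\ge j_0$. For $\alpha<2$, let $\mathcal C_\alpha(\mathbb R^d)$ be the set of all $\mu\in I(\mathbb R^d)$ whose Lévy measure $\nu$ (in the Lévy–Khintchine representation of $\widehat\mu$) satisfies $\lim_{r\to\infty}r^\alpha\,\nu(\{x:|x|>r\})=0$. **Theorem.** Let $\alpha<2$, let $H\subset I(\mathbb R^d)$ be c.c.s.s., and let $\mu\in\mathcal C_\alpha(\mathbb R^d)$. Then $\mu\in\mathfrak Q_\alpha(H)$ if and only if $\mu$ is an $\alpha$-limit of some sequence $(\mu_j)_{j\ge1}$ with $\mu_j\in H$ for all $j\ge1$. -/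

import Mathlib

open MeasureTheory Filter Topology

noncomputable section

namespace AlphaSD

/-- The Borel probability measures on `ℝ^d`, with the topology of weak convergence. -/
abbrev Prob (d : ℕ) : Type := ProbabilityMeasure (EuclideanSpace ℝ (Fin d))

/-- The `n`-fold convolution of `ρ` with itself. -/
def iterConv {d : ℕ} (ρ : Measure (EuclideanSpace ℝ (Fin d))) :
    ℕ → Measure (EuclideanSpace ℝ (Fin d))
  | 0 => Measure.dirac 0
  | n + 1 => Measure.conv (iterConv ρ n) ρ

/-- The class `I(ℝ^d)` of infinitely divisible distributions: for every `n ≥ 1`, `μ` is the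
`n`-fold convolution of some probability measure with itself. -/
def infDiv (d : ℕ) : Set (Prob d) :=
  {μ | ∀ n : ℕ, 1 ≤ n → ∃ ρ : Prob d,
    iterConv (ρ : Measure (EuclideanSpace ℝ (Fin d))) n = (μ : Measure (EuclideanSpace ℝ (Fin d)))}

/-- `C` is a continuous logarithm of the characteristic function of `μ`, normalized by `C 0 = 0`.
There is at most one, and there is one for every infinitely divisible `μ`. -/
def IsCumulant {d : ℕ} (μ : Prob d) (C : EuclideanSpace ℝ (Fin d) → ℂ) : Prop :=
  Continuous C ∧ C 0 = 0 ∧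
    ∀ z, charFun (μ : Measure (EuclideanSpace ℝ (Fin d))) z = Complex.exp (C z)

open Classical in
/-- The cumulant function `C_μ` (the value `0` for distributions that have none is never used:
below it is only applied to infinitely divisible distributions). -/
def cumulant {d : ℕ} (μ : Prob d) : EuclideanSpace ℝ (Fin d) → ℂ :=
  if h : ∃ C, IsCumulant μ C then h.choose else 0

/-- The power `μ̂(z)^t := exp (t C_μ(z))` of the characteristic function. -/
def charPow {d : ℕ} (μ : Prob d) (t : ℝ) (z : EuclideanSpace ℝ (Fin d)) : ℂ :=
  Complex.exp ((t : ℂ) * cumulant μ z)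

/-- `ρ` is the `t`-th convolution `μ^t` of `μ`. -/
def IsConvPower {d : ℕ} (μ : Prob d) (t : ℝ) (ρ : Prob d) : Prop :=
  ∀ z, charFun (ρ : Measure (EuclideanSpace ℝ (Fin d))) z = charPow μ t z

/-- `H` is completely closed in the strong sense: `H` consists of infinitely divisible
distributions and is closed under convolution, weak convergence, type equivalence, and `t`-th
convolution for every `t > 0`. -/
structure IsCCSS {d : ℕ} (H : Set (Prob d)) : Prop where
  subset_infDiv : H ⊆ infDiv d
  conv : ∀ μ ∈ H, ∀ ν ∈ H, ∀ ρ : Prob d,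
    (ρ : Measure (EuclideanSpace ℝ (Fin d))) =
      Measure.conv (μ : Measure (EuclideanSpace ℝ (Fin d))) ν → ρ ∈ H
  weak_limit : ∀ (μs : ℕ → Prob d) (μ : Prob d),
    (∀ n, μs n ∈ H) → Tendsto μs atTop (𝓝 μ) → μ ∈ H
  type_equiv : ∀ μ ∈ H, ∀ (a : ℝ) (c : EuclideanSpace ℝ (Fin d)), 0 < a → ∀ ρ : Prob d,
    (ρ : Measure (EuclideanSpace ℝ (Fin d))) =
      Measure.map (fun x => a • x + c) (μ : Measure (EuclideanSpace ℝ (Fin d))) → ρ ∈ H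
  conv_power : ∀ μ ∈ H, ∀ t : ℝ, 0 < t → ∀ ρ : Prob d, IsConvPower μ t ρ → ρ ∈ H

/-- The Lévy-Khintchine exponent with the centering function `x / (1 + |x|²)`. -/
def lkExponent {d : ℕ} (A : Matrix (Fin d) (Fin d) ℝ) (ν : Measure (EuclideanSpace ℝ (Fin d)))
    (γ z : EuclideanSpace ℝ (Fin d)) : ℂ :=
  -(1 / 2 : ℂ) * ((∑ i, ∑ j, z i * A i j * z j : ℝ) : ℂ)
    + Complex.I * ((inner ℝ γ z : ℝ) : ℂ)
    + ∫ x, (Complex.exp (Complex.I * ((inner ℝ z x : ℝ) : ℂ)) - 1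
        - Complex.I * ((inner ℝ z x / (1 + ‖x‖ ^ 2) : ℝ) : ℂ)) ∂ν

/-- `(A, ν, γ)` is the Lévy-Khintchine triplet of `μ`. -/
structure HasTriplet {d : ℕ} (μ : Prob d) (A : Matrix (Fin d) (Fin d) ℝ)
    (ν : Measure (EuclideanSpace ℝ (Fin d))) (γ : EuclideanSpace ℝ (Fin d)) : Prop where
  posSemidef : A.PosSemidef
  zero : ν {0} = 0
  finite : ∫⁻ x, ENNReal.ofReal (min (‖x‖ ^ 2) 1) ∂ν < ⊤
  charFun_eq : ∀ z, charFun (μ : Measure (EuclideanSpace ℝ (Fin d))) z =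
    Complex.exp (lkExponent A ν γ z)

/-- The class `𝒞_α(ℝ^d)`: infinitely divisible distributions whose Lévy measure `ν` satisfies
`r^α ν{|x| > r} → 0` as `r → ∞`. (The triplet of `μ` is unique.) -/
def classC (d : ℕ) (α : ℝ) : Set (Prob d) :=
  {μ | μ ∈ infDiv d ∧ ∃ A ν γ, HasTriplet μ A ν γ ∧
    Tendsto (fun r : ℝ => r ^ α * (ν {x | r < ‖x‖}).toReal) atTop (𝓝 0)}

/-- `μ` arises from the sequence `μ_1, μ_2, …` by the limit scheme with index `α`: there are
`0 < a_n ↑ ∞` with `a_{n+1} / a_n → 1`, `c_n ∈ ℝ^d`, and `p_n > 0` with `p_n / a_n^α → 1`, such that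
`∏_{j=1}^n μ̂_j(a_n⁻¹ z)^{p_n} e^{i⟨c_n, z⟩} → μ̂(z)` for all `z`.
Sequences are indexed by `n = 1, 2, …`; the value at `0` is irrelevant. -/
def IsLimitOf {d : ℕ} (α : ℝ) (μs : ℕ → Prob d) (μ : Prob d) : Prop :=
  ∃ (a : ℕ → ℝ) (c : ℕ → EuclideanSpace ℝ (Fin d)) (p : ℕ → ℝ),
    (∀ n, 1 ≤ n → 0 < a n) ∧ MonotoneOn a (Set.Ici 1) ∧ Tendsto a atTop atTop ∧
    Tendsto (fun n => a (n + 1) / a n) atTop (𝓝 1) ∧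
    (∀ n, 1 ≤ n → 0 < p n) ∧ Tendsto (fun n => p n / a n ^ α) atTop (𝓝 1) ∧
    ∀ z, Tendsto
      (fun n => (∏ j ∈ Finset.Icc 1 n, charPow (μs j) (p n) ((a n)⁻¹ • z))
        * Complex.exp (Complex.I * ((inner ℝ (c n) z : ℝ) : ℂ)))
      atTop (𝓝 (charFun (μ : Measure (EuclideanSpace ℝ (Fin d))) z))

/-- The class `𝔔_α(H)`: the `μ_j` are infinitely divisible, and in `H` from some `j₀` on. -/
def classQ {d : ℕ} (α : ℝ) (H : Set (Prob d)) : Set (Prob d) :=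
  {μ | ∃ μs : ℕ → Prob d, (∀ j, 1 ≤ j → μs j ∈ infDiv d) ∧
    (∃ j₀, 1 ≤ j₀ ∧ ∀ j, j₀ ≤ j → μs j ∈ H) ∧ IsLimitOf α μs μ}

end AlphaSD

end

/-!
Only the passage from "eventually in `H`" to "always in `H`" needs an argument. The finitely many
`μ_j` outside `H` are replaced by the distribution concentrated at the origin, which belongs to
every nonempty `H` (shrink a member of `H`) and has `charPow` equal to `1`. This is harmless as
soon as each single factor `μ̂_j(z / a_n) ^ p_n` tends to `1` after a suitable centering, since the
centerings can be absorbed into `c_n` (`IsLimitOf.replace_diracZero`).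

Write `ψ_j = -Re C_{μ_j} ≥ 0` and `G = -log |μ̂|`. All factors of the product have modulus at most
`1`, hence `limsup p_n ψ_j(z / a_n) ≤ G z` (`eventually_mul_neg_re_cumulant_le`). The limit scheme
is almost invariant under scaling: for `r > 0` there are indices `m(n)` with `a_{m(n)} ≈ r a_n`,
hence `p_n ≈ r ^ (-α) p_{m(n)}` and `z / a_n ≈ r z / a_{m(n)}`. This improves the upper bound to a
multiple of `r ^ (-α) G (r z)` (`tendsto_zero_of_limsup_le`). The error made in the argument of `ψ_j`
is controlled by the inequality `ψ (x - y) ≤ 2 ψ x + 2 ψ y` (`neg_re_cumulant_sub_le`) together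
with a Baire category argument near the origin (`exists_uniform_small_near_zero`). Since `μ` is of
class `𝒞_α` and `α < 2`, the bound becomes arbitrarily small for suitable `r`: the tail condition
makes the truncated second moment of the Lévy measure `o(a ^ (2 - α))`
(`tendsto_truncMoment`, `exists_rpow_mul_neg_re_lkExponent_le`).

So `|μ̂_j(z / a_n) ^ p_n| → 1`, and the symmetrized distributions converge to the one concentrated
at the origin by Lévy's continuity theorem. Choosing centers well gives the required convergence
(`exists_shift_tendsto_one`, `exists_shift_charPow_tendsto_one`).
-/

namespace AlphaSD

variable {d : ℕ}

/-! ### Cumulants and convolution powers -/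

/-- A continuous logarithm on `ℝ^d` is determined by its value at the origin. -/
lemma eq_of_exp_eq {f g : EuclideanSpace ℝ (Fin d) → ℂ} (hf : Continuous f) (hg : Continuous g)
    (h0 : f 0 = g 0) (h : ∀ z, Complex.exp (f z) = Complex.exp (g z)) : f = g :=
  Complex.isCoveringMap_exp.eq_of_comp_eq hf hg
    (funext fun z => Subtype.ext (h z)) 0 h0

lemma continuous_cumulant (μ : Prob d) : Continuous (cumulant μ) := by
  unfold cumulant
  split_ifs with h
  · exact h.choose_spec.1
  · exact continuous_const

lemma isCumulant_cumulant {μ : Prob d} (h : ∃ C, IsCumulant μ C) : IsCumulant μ (cumulant μ) := by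
  unfold cumulant
  rw [dif_pos h]
  exact h.choose_spec

lemma cumulant_eq_zero {μ : Prob d} (h : ¬ ∃ C, IsCumulant μ C) : cumulant μ = 0 := by
  unfold cumulant
  rw [dif_neg h]

lemma IsCumulant.cumulant_eq {μ : Prob d} {C : EuclideanSpace ℝ (Fin d) → ℂ}
    (h : IsCumulant μ C) : cumulant μ = C := by
  have h' := isCumulant_cumulant ⟨C, h⟩
  exact eq_of_exp_eq h'.1 h.1 (h'.2.1.trans h.2.1.symm) fun z => by rw [← h'.2.2, ← h.2.2]

lemma re_cumulant_nonpos (μ : Prob d) (z : EuclideanSpace ℝ (Fin d)) :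
    (cumulant μ z).re ≤ 0 := by
  by_cases h : ∃ C, IsCumulant μ C
  · have h1 := norm_charFun_le_one (μ := (μ : Measure (EuclideanSpace ℝ (Fin d)))) z
    rw [(isCumulant_cumulant h).2.2 z, Complex.norm_exp] at h1
    exact Real.exp_le_one_iff.1 h1
  · simp [cumulant_eq_zero h]

lemma norm_charPow (μ : Prob d) (t : ℝ) (z : EuclideanSpace ℝ (Fin d)) :
    ‖charPow μ t z‖ = Real.exp (t * (cumulant μ z).re) := by
  simp [charPow, Complex.norm_exp]

lemma norm_charPow_le_one (μ : Prob d) {t : ℝ} (ht : 0 ≤ t) (z : EuclideanSpace ℝ (Fin d)) :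
    ‖charPow μ t z‖ ≤ 1 := by
  rw [norm_charPow, Real.exp_le_one_iff]
  exact mul_nonpos_of_nonneg_of_nonpos ht (re_cumulant_nonpos μ z)

/-- The distribution concentrated at the origin. -/
noncomputable def diracZero (d : ℕ) : Prob d := ⟨Measure.dirac 0, inferInstance⟩

lemma charFun_diracZero (z : EuclideanSpace ℝ (Fin d)) :
    charFun (diracZero d : Measure (EuclideanSpace ℝ (Fin d))) z = 1 := by
  simp [diracZero]

lemma charPow_diracZero (t : ℝ) (z : EuclideanSpace ℝ (Fin d)) :
    charPow (diracZero d) t z = 1 := by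
  have : IsCumulant (diracZero d) 0 :=
    ⟨continuous_const, rfl, fun z => by simp [charFun_diracZero]⟩
  simp [charPow, this.cumulant_eq]

instance isProbabilityMeasure_iterConv (ρ : Measure (EuclideanSpace ℝ (Fin d)))
    [IsProbabilityMeasure ρ] (n : ℕ) : IsProbabilityMeasure (iterConv ρ n) := by
  induction n with
  | zero => unfold iterConv; infer_instance
  | succ n ih => unfold iterConv; infer_instance

lemma charFun_iterConv (ρ : Measure (EuclideanSpace ℝ (Fin d))) [IsProbabilityMeasure ρ] (n : ℕ)
    (z : EuclideanSpace ℝ (Fin d)) : charFun (iterConv ρ n) z = charFun ρ z ^ n := by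
  induction n with
  | zero => simp [iterConv]
  | succ n ih => rw [iterConv, charFun_conv, ih, pow_succ]

/-- A convolution root has characteristic function `exp (C / n)`: the quotient of the two is a
continuous function with values in the finite set of `n`-th roots of unity. -/
lemma charFun_eq_exp_div {ρ : Prob d} {C : EuclideanSpace ℝ (Fin d) → ℂ} (hC : Continuous C)
    (hC0 : C 0 = 0) {n : ℕ} (hn : 1 ≤ n)
    (h : ∀ z, charFun (ρ : Measure (EuclideanSpace ℝ (Fin d))) z ^ n = Complex.exp (C z))
    (z : EuclideanSpace ℝ (Fin d)) :
    charFun (ρ : Measure (EuclideanSpace ℝ (Fin d))) z = Complex.exp (C z / n) := by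
  have hn0 : (n : ℂ) ≠ 0 := by exact_mod_cast (by omega : n ≠ 0)
  let T : Set ℂ := {w | w ^ n = 1}
  have hT : T.Finite := by
    have : T ⊆ ((Polynomial.nthRoots n (1 : ℂ)).toFinset : Set ℂ) := fun w hw => by
      simpa [Polynomial.mem_nthRoots (by omega : 0 < n)] using (show w ^ n = 1 from hw)
    exact (Finset.finite_toSet _).subset this
  let f : EuclideanSpace ℝ (Fin d) → ℂ := fun z =>
    charFun (ρ : Measure (EuclideanSpace ℝ (Fin d))) z * Complex.exp (-(C z / n))
  have hf : Continuous f := continuous_charFun.mul (by fun_prop)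
  have hfT : ∀ z, f z ∈ T := fun z => by
    change (_ * _) ^ n = 1
    rw [mul_pow, h, ← Complex.exp_nat_mul, ← Complex.exp_add, mul_neg, mul_div_cancel₀ _ hn0,
      add_neg_cancel, Complex.exp_zero]
  have hz := isPreconnected_univ.constant_of_mapsTo (T := T) (f := f) hT.isDiscrete
    hf.continuousOn (fun z _ => hfT z) (Set.mem_univ z) (Set.mem_univ 0)
  simp only [f, hC0, charFun_zero, probReal_univ, zero_div, neg_zero, Complex.exp_zero,
    mul_one, Complex.ofReal_one] at hz
  rw [Complex.exp_neg, mul_inv_eq_one₀ (Complex.exp_ne_zero _)] at hz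
  exact hz

/-- Rational convolution powers of infinitely divisible distributions exist. -/
lemma exists_charFun_eq_charPow_rat {μ : Prob d} (hμ : μ ∈ infDiv d) (k : ℕ) {m : ℕ} (hm : 1 ≤ m) :
    ∃ ρ : Prob d, ∀ z, charFun (ρ : Measure (EuclideanSpace ℝ (Fin d))) z =
      charPow μ ((k : ℝ) / m) z := by
  by_cases h : ∃ C, IsCumulant μ C
  · obtain ⟨hc, h0, he⟩ := isCumulant_cumulant h
    obtain ⟨ρ, hρ⟩ := hμ m hm
    refine ⟨⟨iterConv ρ k, inferInstance⟩, fun z => ?_⟩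
    have := charFun_eq_exp_div (ρ := ρ) hc h0 hm
      (fun z => by rw [← charFun_iterConv, hρ, he z]) z
    rw [ProbabilityMeasure.coe_mk, charFun_iterConv, this, ← Complex.exp_nat_mul, charPow]
    congr 1
    push_cast
    ring
  · -- Every infinitely divisible distribution has a continuous logarithm, but that is not needed:
    -- without one, `charPow` is `1` by the convention in `cumulant`.
    exact ⟨diracZero d, fun z => by simp [charFun_diracZero, charPow, cumulant_eq_zero h]⟩

lemma one_sub_re_charFun (ρ : Prob d) (z : EuclideanSpace ℝ (Fin d)) :
    Integrable (fun x => 1 - Real.cos (inner ℝ x z)) (ρ : Measure (EuclideanSpace ℝ (Fin d))) ∧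
    1 - (charFun (ρ : Measure (EuclideanSpace ℝ (Fin d))) z).re =
      ∫ x, (1 - Real.cos (inner ℝ x z)) ∂(ρ : Measure (EuclideanSpace ℝ (Fin d))) := by
  have hi : Integrable (fun x => Complex.exp ((inner ℝ x z : ℝ) * Complex.I))
      (ρ : Measure (EuclideanSpace ℝ (Fin d))) := by
    refine (integrable_const (1 : ℝ)).mono' (by fun_prop) (ae_of_all _ fun x => ?_)
    rw [Complex.norm_exp_ofReal_mul_I]
  have hre : ∀ x, (Complex.exp ((inner ℝ x z : ℝ) * Complex.I)).re = Real.cos (inner ℝ x z) :=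
    fun x => Complex.exp_ofReal_mul_I_re _
  have hc : Integrable (fun x => Real.cos (inner ℝ x z))
      (ρ : Measure (EuclideanSpace ℝ (Fin d))) := by
    simp only [← hre]
    exact hi.re
  refine ⟨(integrable_const 1).sub hc, ?_⟩
  rw [integral_sub (integrable_const 1) hc, charFun_apply]
  simp only [integral_const, probReal_univ, smul_eq_mul, mul_one, ← hre]
  congr 1
  exact (integral_re hi).symm

lemma one_sub_cos_sub_le (a b : ℝ) :
    1 - Real.cos (a - b) ≤ 2 * (1 - Real.cos a) + 2 * (1 - Real.cos b) := by
  rw [Real.cos_sub]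
  nlinarith [sq_nonneg (Real.sin a - Real.sin b), sq_nonneg (Real.cos a + Real.cos b - 2),
    sq_nonneg (Real.sin a + Real.sin b), sq_nonneg (Real.cos a - Real.cos b),
    Real.sin_sq_add_cos_sq a, Real.sin_sq_add_cos_sq b]

lemma one_sub_re_charFun_sub_le (ρ : Prob d) (x y : EuclideanSpace ℝ (Fin d)) :
    1 - (charFun (ρ : Measure (EuclideanSpace ℝ (Fin d))) (x - y)).re ≤
      2 * (1 - (charFun (ρ : Measure (EuclideanSpace ℝ (Fin d))) x).re) +
      2 * (1 - (charFun (ρ : Measure (EuclideanSpace ℝ (Fin d))) y).re) := by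
  obtain ⟨i1, e1⟩ := one_sub_re_charFun ρ x
  obtain ⟨i2, e2⟩ := one_sub_re_charFun ρ y
  obtain ⟨i3, e3⟩ := one_sub_re_charFun ρ (x - y)
  rw [e1, e2, e3, ← integral_const_mul, ← integral_const_mul,
    ← integral_add (i1.const_mul 2) (i2.const_mul 2)]
  refine integral_mono i3 ((i1.const_mul 2).add (i2.const_mul 2)) fun v => ?_
  simp only [inner_sub_right]
  exact one_sub_cos_sub_le _ _

lemma tendsto_mul_one_sub_re_exp_div (w : ℂ) :
    Tendsto (fun m : ℕ => (m : ℝ) * (1 - (Complex.exp (w / m)).re)) atTop (𝓝 (-w.re)) := by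
  have h : HasDerivAt (fun t : ℝ => (Complex.exp (t * w)).re) w.re 0 := by
    have h1 : HasDerivAt (fun t : ℂ => Complex.exp (t * w)) w ((0 : ℝ) : ℂ) := by
      simpa using ((hasDerivAt_id ((0 : ℝ) : ℂ)).mul_const w).cexp
    exact h1.real_of_complex
  have h2 := h.tendsto_slope_zero
  have h3 : Tendsto (fun m : ℕ => ((m : ℝ))⁻¹) atTop (𝓝[≠] 0) :=
    (tendsto_inv_atTop_nhdsGT_zero.comp tendsto_natCast_atTop_atTop).mono_right
      (nhdsWithin_mono _ fun x hx => ne_of_gt hx)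
  refine ((h2.comp h3).neg).congr fun m => ?_
  simp only [Function.comp_apply, inv_inv, zero_add, Complex.ofReal_zero, zero_mul,
    Complex.exp_zero, Complex.one_re, smul_eq_mul]
  rw [show ((((m : ℝ))⁻¹ : ℝ) : ℂ) * w = w / m by push_cast; field_simp]
  ring

/-- Writing `ψ = -Re C`, one has `ψ (x - y) ≤ 2 ψ x + 2 ψ y`: it is the limit of the
corresponding inequalities for `m (1 - Re exp (C / m))`, and `exp (C / m)` is a characteristic
function. -/
lemma neg_re_cumulant_sub_le {μ : Prob d} (hμ : μ ∈ infDiv d) (x y : EuclideanSpace ℝ (Fin d)) :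
    -(cumulant μ (x - y)).re ≤ 2 * -(cumulant μ x).re + 2 * -(cumulant μ y).re := by
  have hx := tendsto_mul_one_sub_re_exp_div (cumulant μ x)
  have hy := tendsto_mul_one_sub_re_exp_div (cumulant μ y)
  have hxy := tendsto_mul_one_sub_re_exp_div (cumulant μ (x - y))
  refine le_of_tendsto_of_tendsto hxy ((hx.const_mul 2).add (hy.const_mul 2)) ?_
  filter_upwards [eventually_ge_atTop 1] with m hm
  obtain ⟨ρ, hρ⟩ := exists_charFun_eq_charPow_rat hμ 1 hm
  have h := one_sub_re_charFun_sub_le ρ x y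
  have e : ∀ z, charPow μ (((1 : ℕ) : ℝ) / m) z = Complex.exp (cumulant μ z / m) := fun z => by
    rw [charPow]; congr 1; push_cast; ring
  simp only [hρ, e] at h
  have := mul_le_mul_of_nonneg_left h (Nat.cast_nonneg (α := ℝ) m)
  linarith

/-! ### Asymptotically degenerate sequences -/

/-- The distribution of the difference of two independent variables with distribution `ρ`. -/
noncomputable def symmetrization (ρ : Prob d) : Prob d :=
  ⟨((ρ : Measure (EuclideanSpace ℝ (Fin d))).prod ρ).map (fun p => p.1 - p.2),
    Measure.isProbabilityMeasure_map (by fun_prop)⟩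

lemma charFun_symmetrization (ρ : Prob d) (z : EuclideanSpace ℝ (Fin d)) :
    charFun (symmetrization ρ : Measure (EuclideanSpace ℝ (Fin d))) z =
      ((‖charFun (ρ : Measure (EuclideanSpace ℝ (Fin d))) z‖ ^ 2 : ℝ) : ℂ) := by
  rw [symmetrization, ProbabilityMeasure.coe_mk, charFun_apply,
    integral_map (by fun_prop) (by fun_prop)]
  have : ∀ p : EuclideanSpace ℝ (Fin d) × EuclideanSpace ℝ (Fin d),
      Complex.exp ((inner ℝ (p.1 - p.2) z : ℝ) * Complex.I) =
      Complex.exp ((inner ℝ p.1 z : ℝ) * Complex.I) *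
        Complex.exp ((inner ℝ p.2 (-z) : ℝ) * Complex.I) := fun p => by
    rw [← Complex.exp_add, inner_sub_left, inner_neg_right]
    push_cast
    ring_nf
  simp_rw [this]
  rw [integral_prod_mul (fun x => Complex.exp ((inner ℝ x z : ℝ) * Complex.I))
    (fun x => Complex.exp ((inner ℝ x (-z) : ℝ) * Complex.I)), ← charFun_apply, ← charFun_apply,
    charFun_neg, Complex.mul_conj, Complex.normSq_eq_norm_sq]

/-- The bounded continuous function `x ↦ min ‖x‖ 1`. -/
noncomputable def truncNorm (d : ℕ) :
    BoundedContinuousFunction (EuclideanSpace ℝ (Fin d)) ℝ :=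
  BoundedContinuousFunction.ofNormedAddCommGroup (fun x => min ‖x‖ 1) (by fun_prop) 1
    (fun x => by
      rw [Real.norm_of_nonneg (le_min (norm_nonneg x) zero_le_one)]
      exact min_le_right _ _)

lemma truncNorm_apply (x : EuclideanSpace ℝ (Fin d)) : truncNorm d x = min ‖x‖ 1 := rfl

/-- Some centre `y` does at least as well as an independent copy of the variable. -/
lemma exists_integral_truncNorm_sub_le (ρ : Prob d) :
    ∃ y, ∫ x, truncNorm d (x - y) ∂(ρ : Measure (EuclideanSpace ℝ (Fin d))) ≤
      ∫ x, truncNorm d x ∂(symmetrization ρ : Measure (EuclideanSpace ℝ (Fin d))) := by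
  have hi : Integrable (fun p : EuclideanSpace ℝ (Fin d) × EuclideanSpace ℝ (Fin d) =>
      truncNorm d (p.1 - p.2)) ((ρ : Measure (EuclideanSpace ℝ (Fin d))).prod ρ) :=
    (integrable_const (1 : ℝ)).mono' (by fun_prop) (ae_of_all _ fun p => by
      rw [truncNorm_apply, Real.norm_of_nonneg (le_min (norm_nonneg _) zero_le_one)]
      exact min_le_right _ _)
  rw [symmetrization, ProbabilityMeasure.coe_mk, integral_map (by fun_prop) (by fun_prop),
    integral_prod_symm _ hi]
  exact exists_le_integral hi.integral_prod_right

lemma norm_charFun_mul_exp_sub_one_le (ρ : Prob d) (y z : EuclideanSpace ℝ (Fin d)) :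
    ‖charFun (ρ : Measure (EuclideanSpace ℝ (Fin d))) z *
        Complex.exp (Complex.I * ((inner ℝ (-y) z : ℝ) : ℂ)) - 1‖ ≤
      (‖z‖ + 2) * ∫ x, truncNorm d (x - y) ∂(ρ : Measure (EuclideanSpace ℝ (Fin d))) := by
  have e : charFun (ρ : Measure (EuclideanSpace ℝ (Fin d))) z *
        Complex.exp (Complex.I * ((inner ℝ (-y) z : ℝ) : ℂ)) - 1 =
      ∫ x, (Complex.exp (Complex.I * ((inner ℝ (x - y) z : ℝ) : ℂ)) - 1)
        ∂(ρ : Measure (EuclideanSpace ℝ (Fin d))) := by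
    have hi : Integrable (fun x => Complex.exp (Complex.I * ((inner ℝ (x - y) z : ℝ) : ℂ)))
        (ρ : Measure (EuclideanSpace ℝ (Fin d))) := by
      refine (integrable_const (1 : ℝ)).mono' (by fun_prop) (ae_of_all _ fun x => ?_)
      rw [Complex.norm_exp_I_mul_ofReal]
    rw [integral_sub hi (integrable_const 1), charFun_apply, ← integral_mul_const]
    simp only [integral_const, probReal_univ, one_smul]
    congr 2
    ext x
    rw [← Complex.exp_add, inner_sub_left, inner_neg_left]
    push_cast
    ring_nf
  have hi : Integrable (fun x => truncNorm d (x - y))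
      (ρ : Measure (EuclideanSpace ℝ (Fin d))) :=
    (integrable_const (1 : ℝ)).mono' (by fun_prop) (ae_of_all _ fun p => by
      rw [truncNorm_apply, Real.norm_of_nonneg (le_min (norm_nonneg _) zero_le_one)]
      exact min_le_right _ _)
  rw [e, ← integral_const_mul]
  refine norm_integral_le_of_norm_le (hi.const_mul _) (ae_of_all _ fun x => ?_)
  rw [truncNorm_apply]
  have h1 : ‖Complex.exp (Complex.I * ((inner ℝ (x - y) z : ℝ) : ℂ)) - 1‖ ≤ ‖x - y‖ * ‖z‖ :=
    (Real.norm_exp_I_mul_ofReal_sub_one_le).trans (norm_inner_le_norm _ _)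
  have h2 : ‖Complex.exp (Complex.I * ((inner ℝ (x - y) z : ℝ) : ℂ)) - 1‖ ≤ 2 := by
    refine (norm_sub_le _ _).trans ?_
    rw [Complex.norm_exp_I_mul_ofReal, norm_one]
    norm_num
  rcases le_total ‖x - y‖ 1 with h | h
  · rw [min_eq_left h]
    nlinarith [norm_nonneg (x - y)]
  · rw [min_eq_right h]
    linarith [norm_nonneg z]

/-- If the moduli of the characteristic functions tend to `1`, then suitable translates converge
to the distribution concentrated at the origin: the symmetrizations do, by Lévy's continuity
theorem. -/
lemma exists_shift_tendsto_one {M : ℕ → Prob d}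
    (h : ∀ z, Tendsto (fun n => ‖charFun (M n : Measure (EuclideanSpace ℝ (Fin d))) z‖)
      atTop (𝓝 1)) :
    ∃ b : ℕ → EuclideanSpace ℝ (Fin d), ∀ z,
      Tendsto (fun n => charFun (M n : Measure (EuclideanSpace ℝ (Fin d))) z *
        Complex.exp (Complex.I * ((inner ℝ (b n) z : ℝ) : ℂ))) atTop (𝓝 1) := by
  have hS : Tendsto (fun n => symmetrization (M n)) atTop (𝓝 (diracZero d)) := by
    rw [ProbabilityMeasure.tendsto_iff_tendsto_charFun]
    intro z
    simp only [charFun_symmetrization, charFun_diracZero]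
    simpa [Function.comp_def] using (Complex.continuous_ofReal.tendsto _).comp ((h z).pow 2)
  have hI := (ProbabilityMeasure.tendsto_iff_forall_integral_tendsto.1 hS) (truncNorm d)
  have h0 : ∫ x, truncNorm d x ∂(diracZero d : Measure (EuclideanSpace ℝ (Fin d))) = 0 := by
    simp [diracZero, truncNorm_apply]
  rw [h0] at hI
  choose y hy using fun n => exists_integral_truncNorm_sub_le (M n)
  refine ⟨fun n => -y n, fun z => ?_⟩
  rw [tendsto_iff_norm_sub_tendsto_zero]
  refine squeeze_zero (fun _ => norm_nonneg _)
    (fun n => (norm_charFun_mul_exp_sub_one_le (M n) (y n) z).trans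
      (mul_le_mul_of_nonneg_left (hy n) (by positivity))) ?_
  simpa using hI.const_mul (‖z‖ + 2)

lemma exists_natCast_div_close {p δ : ℝ} (hp : 0 ≤ p) (hδ : 0 < δ) :
    ∃ k m : ℕ, 1 ≤ m ∧ |p - (k : ℝ) / m| < δ := by
  obtain ⟨q, hq1, hq2⟩ := exists_rat_btwn (lt_add_of_pos_right p hδ)
  have hq0 : 0 ≤ q := by exact_mod_cast hp.trans hq1.le
  refine ⟨q.num.toNat, q.den, q.den_pos, ?_⟩
  have : ((q.num.toNat : ℕ) : ℝ) / q.den = q := by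
    have h1 : ((q.num.toNat : ℕ) : ℝ) = ((q.num : ℤ) : ℝ) := by
      exact_mod_cast Int.toNat_of_nonneg (Rat.num_nonneg.2 hq0)
    rw [h1, Rat.cast_def]
  rw [this, abs_lt]
  constructor <;> linarith

/-- If `|μ̂(z / a_n) ^ p_n| → 1` for all `z`, then `μ̂(z / a_n) ^ p_n` tends to `1` after
a suitable centering. The exponents `p_n` are replaced by rational ones, for which the power is
the characteristic function of a distribution. -/
lemma exists_shift_charPow_tendsto_one {μ : Prob d} (hμ : μ ∈ infDiv d) {a p : ℕ → ℝ}
    (hp : ∀ n, 1 ≤ n → 0 < p n)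
    (h : ∀ z, Tendsto (fun n => p n * -(cumulant μ ((a n)⁻¹ • z)).re) atTop (𝓝 0)) :
    ∃ b : ℕ → EuclideanSpace ℝ (Fin d), ∀ z,
      Tendsto (fun n => charPow μ (p n) ((a n)⁻¹ • z) *
        Complex.exp (Complex.I * ((inner ℝ (b n) z : ℝ) : ℂ))) atTop (𝓝 1) := by
  have hB : ∀ n : ℕ, ∃ B : ℝ, 0 < B ∧ ∀ z : EuclideanSpace ℝ (Fin d), ‖z‖ ≤ n →
      ‖cumulant μ ((a n)⁻¹ • z)‖ ≤ B := fun n => by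
    obtain ⟨B, hB⟩ := (isCompact_closedBall
      (0 : EuclideanSpace ℝ (Fin d)) n).exists_bound_of_continuousOn
      (f := fun z => cumulant μ ((a n)⁻¹ • z))
      ((continuous_cumulant μ).comp (continuous_const_smul _)).continuousOn
    exact ⟨max B 1, by positivity, fun z hz => (hB z (by simpa using hz)).trans (le_max_left _ _)⟩
  choose B hB0 hB using hB
  have hq : ∀ n : ℕ, ∃ k m : ℕ, 1 ≤ m ∧ (1 ≤ n → |p n - (k : ℝ) / m| < 1 / ((n + 1) * B n)) :=
    fun n => by
      rcases Nat.lt_or_ge n 1 with hn | hn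
      · exact ⟨0, 1, le_rfl, fun h => absurd h (by omega)⟩
      · obtain ⟨k, m, hm, hkm⟩ := exists_natCast_div_close (hp n hn).le
          (δ := 1 / ((n + 1) * B n)) (by have := hB0 n; positivity)
        exact ⟨k, m, hm, fun _ => hkm⟩
  choose k m hm hkm using hq
  -- `(p_n - q_n) C(z / a_n) → 0` for the rational approximations `q_n = k_n / m_n`
  have hdiff : ∀ z, Tendsto (fun n => (((p n - (k n : ℝ) / m n : ℝ)) : ℂ) *
      cumulant μ ((a n)⁻¹ • z)) atTop (𝓝 0) := fun z => by
    refine squeeze_zero_norm' ?_ tendsto_one_div_add_atTop_nhds_zero_nat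
    obtain ⟨N, hN⟩ := exists_nat_ge ‖z‖
    filter_upwards [eventually_ge_atTop N, eventually_ge_atTop 1] with n hn hn1
    rw [norm_mul, Complex.norm_real, Real.norm_eq_abs]
    have h1 := hB n z (hN.trans (by exact_mod_cast hn))
    have h2 := hB0 n
    calc _ ≤ 1 / (((n : ℝ) + 1) * B n) * B n :=
          mul_le_mul (hkm n hn1).le h1 (norm_nonneg _) (by positivity)
      _ = 1 / ((n : ℝ) + 1) := by
          field_simp
  choose ρ hρ using fun n => exists_charFun_eq_charPow_rat hμ (k n) (hm n)
  let M : ℕ → Prob d := fun n =>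
    ⟨(ρ n : Measure (EuclideanSpace ℝ (Fin d))).map ((a n)⁻¹ • ·),
      Measure.isProbabilityMeasure_map (by fun_prop)⟩
  have hM : ∀ n z, charFun (M n : Measure (EuclideanSpace ℝ (Fin d))) z =
      charPow μ ((k n : ℝ) / m n) ((a n)⁻¹ • z) := fun n z => by
    rw [ProbabilityMeasure.coe_mk, charFun_map_smul, hρ]
  have hsplit : ∀ n z, charPow μ (p n) ((a n)⁻¹ • z) =
      charPow μ ((k n : ℝ) / m n) ((a n)⁻¹ • z) *
        Complex.exp (((p n - (k n : ℝ) / m n : ℝ) : ℂ) * cumulant μ ((a n)⁻¹ • z)) :=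
    fun n z => by
      rw [charPow, charPow, ← Complex.exp_add]
      push_cast
      ring_nf
  have hexp : ∀ z, Tendsto (fun n => Complex.exp (((p n - (k n : ℝ) / m n : ℝ) : ℂ) *
      cumulant μ ((a n)⁻¹ • z))) atTop (𝓝 1) := fun z => by
    simpa using (hdiff z).cexp
  obtain ⟨b, hb⟩ := exists_shift_tendsto_one (M := M) (fun z => by
    have h1 := Real.continuous_exp.tendsto 0 |>.comp (by simpa using (h z).neg)
    have h2 := h1.div (hexp z).norm (by simp)
    simp only [Real.exp_zero, norm_one, div_one] at h2
    refine h2.congr fun n => ?_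
    simp only [Pi.div_apply, Function.comp_apply]
    rw [hM, div_eq_iff (norm_ne_zero_iff.2 (Complex.exp_ne_zero _)), ← norm_mul, ← hsplit,
      norm_charPow])
  refine ⟨b, fun z => ?_⟩
  have := (hb z).mul (hexp z)
  rw [mul_one] at this
  refine this.congr fun n => ?_
  rw [hM, hsplit]
  ring

/-! ### Scaling and uniformity near the origin -/

/-- A pointwise asymptotic upper bound that vanishes at the origin holds uniformly near the origin
for quasi-subadditive functions: by Baire's theorem the functions are eventually uniformly small on
some ball, hence on the differences of its points. -/
lemma exists_uniform_small_near_zero {E : Type*} [NormedAddCommGroup E] [CompleteSpace E]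
    {u : ℕ → E → ℝ} (hu : ∀ n, Continuous (u n))
    (hsub : ∀ n x y, 1 ≤ n → u n (x - y) ≤ 2 * u n x + 2 * u n y)
    {G : E → ℝ} (hG : Continuous G) (hG0 : G 0 = 0)
    (h : ∀ z, ∀ η > 0, ∀ᶠ n in atTop, u n z ≤ G z + η) {η : ℝ} (hη : 0 < η) :
    ∃ δ > 0, ∀ᶠ n in atTop, ∀ y, ‖y‖ < δ → u n y ≤ η := by
  let f : Option ℕ → Set E := fun o => o.elim {z | η / 8 ≤ G z}
    (fun N => ⋂ n ∈ Set.Ici N, {z | u n z ≤ η / 4})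
  have hf : ∀ o, IsClosed (f o) := by
    rintro (_ | N)
    · exact isClosed_le continuous_const hG
    · exact isClosed_biInter fun n _ => isClosed_le (hu n) continuous_const
  have hcover : ⋃ o, f o = Set.univ := by
    refine Set.eq_univ_of_forall fun z => ?_
    rw [Set.mem_iUnion]
    by_cases hz : η / 8 ≤ G z
    · exact ⟨none, hz⟩
    · obtain ⟨N, hN⟩ := eventually_atTop.1 (h z (η / 8) (by positivity))
      refine ⟨some N, Set.mem_iInter₂.2 fun n hn => ?_⟩
      have := hN n hn
      change u n z ≤ η / 4
      linarith [not_le.1 hz]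
  have hopen : IsOpen {z | G z < η / 8} := isOpen_lt hG continuous_const
  obtain ⟨z, hz, hzf⟩ := (dense_iUnion_interior_of_closed hf hcover).inter_open_nonempty _ hopen
    ⟨0, by change G 0 < η / 8; rw [hG0]; positivity⟩
  obtain ⟨o, ho⟩ := Set.mem_iUnion.1 hzf
  rcases o with _ | N
  · have h1 : z ∈ f none := interior_subset ho
    exact absurd (show G z < η / 8 from hz) (not_lt.2 (show η / 8 ≤ G z from h1))
  · obtain ⟨δ, hδ, hball⟩ := Metric.mem_nhds_iff.1 (mem_interior_iff_mem_nhds.1 ho)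
    refine ⟨δ, hδ, ?_⟩
    filter_upwards [eventually_ge_atTop N, eventually_ge_atTop 1] with n hn hn1 y hy
    have h1 : u n (z + y) ≤ η / 4 :=
      Set.mem_iInter₂.1 (hball (by simpa [Metric.mem_ball, dist_eq_norm] using hy)) n hn
    have h2 : u n z ≤ η / 4 := Set.mem_iInter₂.1 (interior_subset ho) n hn
    have h3 := hsub n (z + y) z hn1
    rw [add_sub_cancel_left] at h3
    linarith

/-- A norming sequence with `a_{n+1} / a_n → 1` takes values close to `r a_n`, at a later index. -/
lemma exists_index_ratio_tendsto {a : ℕ → ℝ} (ha0 : ∀ n, 1 ≤ n → 0 < a n)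
    (hmono : MonotoneOn a (Set.Ici 1)) (ha : Tendsto a atTop atTop)
    (hratio : Tendsto (fun n => a (n + 1) / a n) atTop (𝓝 1)) {r : ℝ} (hr : 0 < r) :
    ∃ m : ℕ → ℕ, Tendsto m atTop atTop ∧ Tendsto (fun n => a (m n) / a n) atTop (𝓝 r) := by
  have hex : ∀ n, ∃ m, 1 ≤ m ∧ r * a n ≤ a m := fun n =>
    ((eventually_ge_atTop 1).and (ha.eventually_ge_atTop (r * a n))).exists
  classical
  let m : ℕ → ℕ := fun n => Nat.find (hex n)
  have hm1 : ∀ n, 1 ≤ m n := fun n => (Nat.find_spec (hex n)).1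
  have hm2 : ∀ n, r * a n ≤ a (m n) := fun n => (Nat.find_spec (hex n)).2
  have hm3 : ∀ n k, 1 ≤ k → k < m n → a k < r * a n := fun n k hk hkm => by
    have := Nat.find_min (hex n) hkm
    push Not at this
    exact this hk
  have hra : Tendsto (fun n => r * a n) atTop atTop := ha.const_mul_atTop hr
  have hm : Tendsto m atTop atTop := by
    refine tendsto_atTop.2 fun M => ?_
    filter_upwards [hra.eventually_gt_atTop (a (M + 1))] with n hn
    by_contra hlt
    have := hmono (hm1 n) (Set.mem_Ici.2 (by omega : 1 ≤ M + 1)) (by omega : m n ≤ M + 1)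
    linarith [hm2 n]
  refine ⟨m, hm, ?_⟩
  have hup : Tendsto (fun n => r * (a (m n - 1 + 1) / a (m n - 1))) atTop (𝓝 r) := by
    simpa using (hratio.comp ((tendsto_sub_atTop_nat 1).comp hm)).const_mul r
  refine tendsto_of_tendsto_of_tendsto_of_le_of_le' tendsto_const_nhds hup ?_ ?_
  · filter_upwards [eventually_ge_atTop 1] with n hn
    rw [le_div_iff₀ (ha0 n hn)]
    exact hm2 n
  · filter_upwards [eventually_ge_atTop 1, hm.eventually_ge_atTop 2] with n hn hmn
    have h1 := hm3 n (m n - 1) (by omega) (by omega)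
    have h2 := ha0 (m n - 1) (by omega)
    have h3 := ha0 n hn
    have h4 := ha0 (m n) (hm1 n)
    rw [Nat.sub_add_cancel (hm1 n), mul_div_assoc', div_le_div_iff₀ h3 h2]
    nlinarith

/-- If `limsup p_n ψ(z / a_n) ≤ G z` with `p_n ~ a_n ^ α` and `G (r z)` is small compared with
`r ^ α` for suitable `r`, then the limit is `0`: up to an error controlled by quasi-subadditivity,
`z / a_n` is `r z / a_m` with `a_m ≈ r a_n`, and `p_n ≈ r ^ (-α) p_m`. -/
lemma tendsto_zero_of_limsup_le {E : Type*} [NormedAddCommGroup E] [NormedSpace ℝ E]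
    [CompleteSpace E] {ψ G : E → ℝ} {α : ℝ} {a p : ℕ → ℝ}
    (hψ : Continuous ψ) (hψ0 : ∀ z, 0 ≤ ψ z)
    (hsub : ∀ x y, ψ (x - y) ≤ 2 * ψ x + 2 * ψ y) (hG : Continuous G) (hG0 : G 0 = 0)
    (ha0 : ∀ n, 1 ≤ n → 0 < a n)
    (hmono : MonotoneOn a (Set.Ici 1)) (ha : Tendsto a atTop atTop)
    (hratio : Tendsto (fun n => a (n + 1) / a n) atTop (𝓝 1))
    (hp0 : ∀ n, 1 ≤ n → 0 < p n) (hp : Tendsto (fun n => p n / a n ^ α) atTop (𝓝 1))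
    (h : ∀ z, ∀ η > 0, ∀ᶠ n in atTop, p n * ψ ((a n)⁻¹ • z) ≤ G z + η)
    (hsmall : ∀ z, ∀ ε > 0, ∃ r : ℝ, 0 < r ∧ r ^ (-α) * G (r • z) ≤ ε) (z : E) :
    Tendsto (fun n => p n * ψ ((a n)⁻¹ • z)) atTop (𝓝 0) := by
  rw [Metric.tendsto_nhds]
  intro ε hε
  obtain ⟨r, hr, hrG⟩ := hsmall z (ε / 16) (by positivity)
  have hη : 0 < ε * r ^ α / 32 := by positivity
  set η := ε * r ^ α / 32 with hη_def
  obtain ⟨δ, hδ, hnear⟩ := exists_uniform_small_near_zero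
    (u := fun n z => p n * ψ ((a n)⁻¹ • z)) (fun n => by fun_prop)
    (fun n x y hn => by
      have := mul_le_mul_of_nonneg_left (hsub ((a n)⁻¹ • x) ((a n)⁻¹ • y)) (hp0 n hn).le
      simp only [smul_sub]
      linarith) hG hG0 h hη
  obtain ⟨m, hm, hmr⟩ := exists_index_ratio_tendsto ha0 hmono ha hratio hr
  have hshift : Tendsto (fun n => ‖(r - a (m n) / a n) • z‖) atTop (𝓝 0) := by
    simpa using ((hmr.const_sub r).smul_const z).norm
  have hpp : Tendsto (fun n => p n / p (m n)) atTop (𝓝 (r ^ (-α))) := by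
    have h1 := (hp.div (hp.comp hm) one_ne_zero).mul (hmr.rpow_const (p := -α) (Or.inl hr.ne'))
    rw [div_one, one_mul] at h1
    refine h1.congr' ?_
    filter_upwards [eventually_ge_atTop 1, hm.eventually_ge_atTop 1] with n hn hmn
    have h2 := ha0 n hn
    have h3 := ha0 _ hmn
    have h4 := hp0 _ hmn
    simp only [Pi.div_apply, Function.comp_apply]
    rw [Real.div_rpow h3.le h2.le, Real.rpow_neg h3.le, Real.rpow_neg h2.le]
    have h5 := (Real.rpow_pos_of_pos h2 α).ne'
    have h6 := (Real.rpow_pos_of_pos h3 α).ne'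
    field_simp
  have hrα : 0 < r ^ (-α) := by positivity
  filter_upwards [eventually_ge_atTop 1, hm.eventually_ge_atTop 1, hm.eventually hnear,
    hm.eventually (h (r • z) η hη), hshift.eventually_lt_const hδ,
    hpp.eventually_lt_const (by linarith : r ^ (-α) < 2 * r ^ (-α))]
    with n hn hmn h1 h2 h3 h4
  have hpn := hp0 n hn
  have hpm := hp0 _ hmn
  have han := ha0 n hn
  have ham := ha0 _ hmn
  have h5 : (a n)⁻¹ • z =
      (a (m n))⁻¹ • (r • z) - (a (m n))⁻¹ • ((r - a (m n) / a n) • z) := by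
    rw [← smul_sub, ← sub_smul, smul_smul]
    congr 1
    field_simp
    ring
  have h6 := hsub ((a (m n))⁻¹ • (r • z)) ((a (m n))⁻¹ • ((r - a (m n) / a n) • z))
  rw [← h5] at h6
  have h7 := h1 _ h3
  have h8 : p (m n) * ψ ((a n)⁻¹ • z) ≤ 2 * G (r • z) + 4 * η := by
    have := mul_le_mul_of_nonneg_left h6 hpm.le
    linarith
  have h9 : p n * ψ ((a n)⁻¹ • z) ≤ 2 * r ^ (-α) * (2 * G (r • z) + 4 * η) := by
    calc p n * ψ ((a n)⁻¹ • z) = p n / p (m n) * (p (m n) * ψ ((a n)⁻¹ • z)) := by field_simp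
      _ ≤ 2 * r ^ (-α) * (p (m n) * ψ ((a n)⁻¹ • z)) :=
          mul_le_mul_of_nonneg_right h4.le (mul_nonneg hpm.le (hψ0 _))
      _ ≤ _ := mul_le_mul_of_nonneg_left h8 (by positivity)
  have h10 : r ^ (-α) * η = ε / 32 := by
    rw [hη_def, Real.rpow_neg hr.le]
    field_simp
  rw [Real.dist_eq, sub_zero, abs_of_nonneg (mul_nonneg hpn.le (hψ0 _))]
  linarith

/-- A contracting recursion with vanishing forcing term. -/
lemma tendsto_zero_of_le_mul_add {x g : ℕ → ℝ} {q : ℝ} (hx : ∀ k, 0 ≤ x k) (hq0 : 0 ≤ q)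
    (hq1 : q < 1) (hg : Tendsto g atTop (𝓝 0)) (h : ∀ k, x (k + 1) ≤ q * x k + g k) :
    Tendsto x atTop (𝓝 0) := by
  rw [Metric.tendsto_atTop]
  intro ε hε
  have hq : 0 < 1 - q := by linarith
  obtain ⟨K, hK⟩ := eventually_atTop.1
    (hg.eventually_lt_const (show 0 < ε / 2 * (1 - q) by positivity))
  have hind : ∀ j, x (K + j) ≤ q ^ j * x K + ε / 2 := by
    intro j
    induction j with
    | zero => simp; positivity
    | succ j ih =>
      have h1 := h (K + j)
      have h2 := hK (K + j) (by omega)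
      have h3 := mul_le_mul_of_nonneg_left ih hq0
      rw [pow_succ, ← add_assoc]
      linarith
  have hlim : Tendsto (fun j => q ^ j * x K) atTop (𝓝 0) := by
    simpa using (tendsto_pow_atTop_nhds_zero_of_lt_one hq0 hq1).mul_const (x K)
  obtain ⟨J, hJ⟩ := eventually_atTop.1 (hlim.eventually_lt_const (half_pos hε))
  refine ⟨K + J, fun n hn => ?_⟩
  rw [Real.dist_eq, sub_zero, abs_of_nonneg (hx n)]
  have h1 := hind (n - K)
  have h2 := hJ (n - K) (by omega)
  rw [Nat.add_sub_cancel' (by omega)] at h1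
  linarith

/-! ### The exponent near the origin under a tail condition -/

/-- The second moment of `ν`, truncated at radius `a`. -/
noncomputable def truncMoment (ν : Measure (EuclideanSpace ℝ (Fin d))) (a : ℝ) : ℝ :=
  ∫ x, min (‖x‖ ^ 2) (a ^ 2) ∂ν

lemma truncMoment_nonneg (ν : Measure (EuclideanSpace ℝ (Fin d))) (a : ℝ) :
    0 ≤ truncMoment ν a :=
  integral_nonneg fun _ => le_min (sq_nonneg _) (sq_nonneg _)

lemma integrable_min_sq {ν : Measure (EuclideanSpace ℝ (Fin d))}
    (hν : ∫⁻ x, ENNReal.ofReal (min (‖x‖ ^ 2) 1) ∂ν < ⊤) {a : ℝ} (ha : 1 ≤ a) :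
    Integrable (fun x => min (‖x‖ ^ 2) (a ^ 2)) ν := by
  have h1 : Integrable (fun x : EuclideanSpace ℝ (Fin d) => min (‖x‖ ^ 2) 1) ν := by
    refine ⟨by fun_prop, ?_⟩
    rw [hasFiniteIntegral_iff_ofReal
      (ae_of_all _ fun x => le_min (sq_nonneg _) zero_le_one)]
    exact hν
  refine (h1.const_mul (a ^ 2)).mono' (by fun_prop) (ae_of_all _ fun x => ?_)
  rw [Real.norm_of_nonneg (le_min (sq_nonneg _) (sq_nonneg _)),
    mul_min_of_nonneg _ _ (sq_nonneg a), mul_one]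
  exact min_le_min_right _ (le_mul_of_one_le_left (sq_nonneg _) (one_le_pow₀ ha))

lemma measure_norm_gt_lt_top {ν : Measure (EuclideanSpace ℝ (Fin d))}
    (hν : ∫⁻ x, ENNReal.ofReal (min (‖x‖ ^ 2) 1) ∂ν < ⊤) {a : ℝ} (ha : 1 ≤ a) :
    ν {x | a < ‖x‖} < ⊤ := by
  refine lt_of_le_of_lt ?_ hν
  have hs : MeasurableSet {x : EuclideanSpace ℝ (Fin d) | a < ‖x‖} :=
    (isOpen_lt continuous_const continuous_norm).measurableSet
  rw [← lintegral_indicator_one hs]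
  refine lintegral_mono fun x => ?_
  by_cases hx : x ∈ {x : EuclideanSpace ℝ (Fin d) | a < ‖x‖}
  · have h1 : (1 : ℝ) ≤ ‖x‖ ^ 2 := one_le_pow₀ (ha.trans (le_of_lt hx))
    simp [Set.indicator_of_mem hx, min_eq_right h1]
  · simp [Set.indicator_of_notMem hx]

lemma truncMoment_two_mul_le {ν : Measure (EuclideanSpace ℝ (Fin d))}
    (hν : ∫⁻ x, ENNReal.ofReal (min (‖x‖ ^ 2) 1) ∂ν < ⊤) {a : ℝ} (ha : 1 ≤ a) :
    truncMoment ν (2 * a) ≤ truncMoment ν a + 3 * a ^ 2 * (ν {x | a < ‖x‖}).toReal := by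
  have hs : MeasurableSet {x : EuclideanSpace ℝ (Fin d) | a < ‖x‖} :=
    (isOpen_lt continuous_const continuous_norm).measurableSet
  have hi : Integrable ({x : EuclideanSpace ℝ (Fin d) | a < ‖x‖}.indicator
      (fun _ => 3 * a ^ 2)) ν :=
    (integrable_indicator_iff hs).2
      (integrableOn_const (measure_norm_gt_lt_top hν ha).ne)
  have h1 := integrable_min_sq hν ha
  have e : 3 * a ^ 2 * (ν {x | a < ‖x‖}).toReal =
      ∫ x, {x : EuclideanSpace ℝ (Fin d) | a < ‖x‖}.indicator (fun _ => 3 * a ^ 2) x ∂ν := by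
    rw [integral_indicator_const _ hs, smul_eq_mul, mul_comm]
    rfl
  rw [e, truncMoment, truncMoment, ← integral_add h1 hi]
  refine integral_mono (integrable_min_sq hν (by linarith)) (h1.add hi) fun x => ?_
  by_cases hx : a < ‖x‖
  · have h2 : a ^ 2 ≤ ‖x‖ ^ 2 := by nlinarith
    beta_reduce
    rw [Set.indicator_of_mem (show x ∈ {x | a < ‖x‖} from hx), min_eq_right h2]
    refine (min_le_right _ _).trans ?_
    linarith [mul_pow 2 a 2]
  · have h2 : ‖x‖ ^ 2 ≤ a ^ 2 := by nlinarith [norm_nonneg x, not_lt.1 hx]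
    beta_reduce
    rw [Set.indicator_of_notMem (show x ∉ {x | a < ‖x‖} from hx), min_eq_left h2, add_zero]
    exact min_le_left _ _

/-- If `a ^ α ν{|x| > a} → 0` with `α < 2`, the truncated second moment is `o(a ^ (2 - α))`
along `a = 2 ^ k`. -/
lemma tendsto_truncMoment {ν : Measure (EuclideanSpace ℝ (Fin d))} {α : ℝ} (hα : α < 2)
    (hν : ∫⁻ x, ENNReal.ofReal (min (‖x‖ ^ 2) 1) ∂ν < ⊤)
    (htail : Tendsto (fun r : ℝ => r ^ α * (ν {x | r < ‖x‖}).toReal) atTop (𝓝 0)) :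
    Tendsto (fun k : ℕ => ((2 : ℝ) ^ k) ^ (α - 2) * truncMoment ν (2 ^ k)) atTop (𝓝 0) := by
  have hpow : Tendsto (fun k : ℕ => (2 : ℝ) ^ k) atTop atTop :=
    tendsto_pow_atTop_atTop_of_one_lt one_lt_two
  have hg : Tendsto (fun k : ℕ => 3 * (2 : ℝ) ^ (α - 2) *
      (((2 : ℝ) ^ k) ^ α * (ν {x | 2 ^ k < ‖x‖}).toReal)) atTop (𝓝 0) := by
    simpa using (htail.comp hpow).const_mul (3 * (2 : ℝ) ^ (α - 2))
  refine tendsto_zero_of_le_mul_add (q := (2 : ℝ) ^ (α - 2))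
    (fun k => mul_nonneg (by positivity) (truncMoment_nonneg _ _)) (by positivity)
    (Real.rpow_lt_one_of_one_lt_of_neg one_lt_two (by linarith)) hg fun k => ?_
  have h1 := truncMoment_two_mul_le hν (one_le_pow₀ one_le_two (n := k) (M₀ := ℝ))
  have hk : (0 : ℝ) < 2 ^ k := by positivity
  have h2 : ((2 : ℝ) ^ k) ^ α = ((2 : ℝ) ^ k) ^ (α - 2) * ((2 : ℝ) ^ k) ^ 2 := by
    rw [← Real.rpow_natCast ((2 : ℝ) ^ k) 2, ← Real.rpow_add hk]
    norm_num
  rw [pow_succ', Real.mul_rpow (by norm_num) hk.le, h2]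
  have h3 := mul_le_mul_of_nonneg_left h1
    (show 0 ≤ (2 : ℝ) ^ (α - 2) * ((2 : ℝ) ^ k) ^ (α - 2) by positivity)
  linarith

/-- The bound on the real part of the Lévy–Khintchine exponent by the Gaussian covariance and the
truncated second moment of the Lévy measure. -/
lemma neg_re_lkExponent_le {A : Matrix (Fin d) (Fin d) ℝ}
    {ν : Measure (EuclideanSpace ℝ (Fin d))}
    (hν : ∫⁻ x, ENNReal.ofReal (min (‖x‖ ^ 2) 1) ∂ν < ⊤)
    (γ z : EuclideanSpace ℝ (Fin d)) {a : ℝ} (ha : 1 ≤ a) :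
    -(lkExponent A ν γ (a⁻¹ • z)).re ≤
      (a ^ 2)⁻¹ * ((∑ i, ∑ j, z i * A i j * z j) / 2 + (2 + ‖z‖ ^ 2) * truncMoment ν a) := by
  have ha0 : 0 < a := by linarith
  let F : EuclideanSpace ℝ (Fin d) → ℂ := fun x =>
    Complex.exp (Complex.I * ((inner ℝ (a⁻¹ • z) x : ℝ) : ℂ)) - 1
        - Complex.I * ((inner ℝ (a⁻¹ • z) x / (1 + ‖x‖ ^ 2) : ℝ) : ℂ)
  have hFre : ∀ x, -(F x).re = 1 - Real.cos (inner ℝ (a⁻¹ • z) x) := fun x => by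
    have : (Complex.exp (Complex.I * ((inner ℝ (a⁻¹ • z) x : ℝ) : ℂ))).re =
        Real.cos (inner ℝ (a⁻¹ • z) x) := by
      rw [mul_comm, Complex.exp_ofReal_mul_I_re]
    simp only [F, Complex.sub_re, this, Complex.one_re, Complex.re_mul_ofReal, Complex.I_re,
      zero_mul, sub_zero]
    ring
  have hpt : ∀ x, -(F x).re ≤ (a ^ 2)⁻¹ * (2 + ‖z‖ ^ 2) * min (‖x‖ ^ 2) (a ^ 2) := fun x => by
    rw [hFre]
    have hcos1 := Real.one_sub_sq_div_two_le_cos (x := inner ℝ (a⁻¹ • z) x)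
    have hcos2 := Real.neg_one_le_cos (inner ℝ (a⁻¹ • z) x)
    rcases le_total (‖x‖ ^ 2) (a ^ 2) with h | h
    · rw [min_eq_left h]
      have h1 : (inner ℝ (a⁻¹ • z) x) ^ 2 ≤ (a ^ 2)⁻¹ * (‖z‖ ^ 2 * ‖x‖ ^ 2) := by
        rw [real_inner_smul_left, mul_pow, inv_pow, ← mul_pow]
        gcongr ?_ * ?_
        exact sq_le_sq' (by linarith [neg_abs_le (inner ℝ z x), abs_real_inner_le_norm z x])
          (real_inner_le_norm z x)
      have h2 : 0 ≤ (a ^ 2)⁻¹ * ‖x‖ ^ 2 := by positivity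
      have h3 : 0 ≤ (a ^ 2)⁻¹ * (‖z‖ ^ 2 * ‖x‖ ^ 2) := by positivity
      linarith
    · rw [min_eq_right h]
      have h1 : (a ^ 2)⁻¹ * (2 + ‖z‖ ^ 2) * a ^ 2 = 2 + ‖z‖ ^ 2 := by field_simp
      rw [h1]
      linarith [sq_nonneg ‖z‖]
  have hint : -(∫ x, F x ∂ν).re ≤ (a ^ 2)⁻¹ * (2 + ‖z‖ ^ 2) * truncMoment ν a := by
    by_cases hF : Integrable F ν
    · have e : (∫ x, F x ∂ν).re = ∫ x, (F x).re ∂ν := (integral_re hF).symm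
      rw [e, ← integral_neg, truncMoment, ← integral_const_mul]
      exact integral_mono hF.re.neg ((integrable_min_sq hν ha).const_mul _) hpt
    · -- This case does not occur; with the convention `∫ F = 0` the bound holds anyway.
      rw [integral_undef hF, Complex.zero_re, neg_zero]
      have := truncMoment_nonneg ν a
      positivity
  have hquad : (∑ i, ∑ j, (a⁻¹ • z) i * A i j * (a⁻¹ • z) j) =
      (a ^ 2)⁻¹ * ∑ i, ∑ j, z i * A i j * z j := by
    simp only [Finset.mul_sum]
    refine Finset.sum_congr rfl fun i _ => Finset.sum_congr rfl fun j _ => ?_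
    simp only [PiLp.smul_apply, smul_eq_mul]
    field_simp
  have hre : (lkExponent A ν γ (a⁻¹ • z)).re =
      -(1 / 2) * ((a ^ 2)⁻¹ * ∑ i, ∑ j, z i * A i j * z j) + (∫ x, F x ∂ν).re := by
    rw [lkExponent, hquad]
    simp only [Complex.add_re, Complex.re_mul_ofReal, Complex.I_re, zero_mul, add_zero, F]
    norm_num
  rw [hre]
  linarith

/-- For a distribution of class `𝒞_α`, the real part of the exponent at `r z` is `o(r ^ α)` along
`r = 2 ^ (-k)`. -/
lemma exists_rpow_mul_neg_re_lkExponent_le {A : Matrix (Fin d) (Fin d) ℝ}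
    {ν : Measure (EuclideanSpace ℝ (Fin d))} {α : ℝ} (hα : α < 2)
    (hν : ∫⁻ x, ENNReal.ofReal (min (‖x‖ ^ 2) 1) ∂ν < ⊤)
    (htail : Tendsto (fun r : ℝ => r ^ α * (ν {x | r < ‖x‖}).toReal) atTop (𝓝 0))
    (γ z : EuclideanSpace ℝ (Fin d)) {ε : ℝ} (hε : 0 < ε) :
    ∃ r : ℝ, 0 < r ∧ r ^ (-α) * -(lkExponent A ν γ (r • z)).re ≤ ε := by
  set Q : ℝ := ∑ i, ∑ j, z i * A i j * z j
  have hq : Tendsto (fun k : ℕ => ((2 : ℝ) ^ k) ^ (α - 2)) atTop (𝓝 0) := by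
    have h1 : Tendsto (fun x : ℝ => x ^ (α - 2)) atTop (𝓝 0) := by
      simpa using tendsto_rpow_neg_atTop (show 0 < 2 - α by linarith)
    exact h1.comp (tendsto_pow_atTop_atTop_of_one_lt one_lt_two)
  have hlim := (hq.mul_const (Q / 2)).add
    ((tendsto_truncMoment hα hν htail).const_mul (2 + ‖z‖ ^ 2))
  simp only [zero_mul, mul_zero, add_zero] at hlim
  obtain ⟨k, hk⟩ := (hlim.eventually_lt_const hε).exists
  have ha : (0 : ℝ) < 2 ^ k := by positivity
  refine ⟨((2 : ℝ) ^ k)⁻¹, by positivity, ?_⟩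
  have h1 := neg_re_lkExponent_le (A := A) hν γ z (one_le_pow₀ one_le_two (n := k) (M₀ := ℝ))
  rw [Real.rpow_neg (by positivity), Real.inv_rpow ha.le, inv_inv]
  have h2 : ((2 : ℝ) ^ k) ^ (α - 2) = ((2 : ℝ) ^ k) ^ α * (((2 : ℝ) ^ k) ^ 2)⁻¹ := by
    rw [← Real.rpow_natCast ((2 : ℝ) ^ k) 2, ← Real.rpow_neg ha.le, ← Real.rpow_add ha]
    norm_num [sub_eq_add_neg]
  rw [h2] at hk
  have h3 := mul_le_mul_of_nonneg_left h1 (show 0 ≤ ((2 : ℝ) ^ k) ^ α by positivity)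
  linarith

/-! ### Replacing finitely many members of the sequence -/

lemma IsCCSS.diracZero_mem {H : Set (Prob d)} (hH : IsCCSS H) {μ : Prob d} (hμ : μ ∈ H) :
    diracZero d ∈ H := by
  let M : ℕ → Prob d := fun n =>
    ⟨(μ : Measure (EuclideanSpace ℝ (Fin d))).map (fun x => (1 / ((n : ℝ) + 1)) • x + 0),
      Measure.isProbabilityMeasure_map (by fun_prop)⟩
  refine hH.weak_limit M _ (fun n => hH.type_equiv μ hμ _ 0 (by positivity) _ rfl) ?_
  rw [ProbabilityMeasure.tendsto_iff_tendsto_charFun]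
  intro z
  have hM : ∀ n, charFun (M n : Measure (EuclideanSpace ℝ (Fin d))) z =
      charFun (μ : Measure (EuclideanSpace ℝ (Fin d))) ((1 / ((n : ℝ) + 1)) • z) := fun n => by
    simp only [M, add_zero]
    exact charFun_map_smul _ _
  have hz : Tendsto (fun n : ℕ => (1 / ((n : ℝ) + 1)) • z) atTop (𝓝 0) := by
    simpa using (tendsto_one_div_add_atTop_nhds_zero_nat (𝕜 := ℝ)).smul_const z
  have hc : Continuous (charFun (μ : Measure (EuclideanSpace ℝ (Fin d)))) := continuous_charFun
  have h := (hc.tendsto 0).comp hz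
  simp only [charFun_zero, probReal_univ, Complex.ofReal_one] at h
  rw [charFun_diracZero]
  exact h.congr fun n => (hM n).symm

/-- Every factor of the product in the limit scheme has modulus at most `1`, so each of them is
asymptotically at least as large in modulus as the limit. -/
lemma eventually_mul_neg_re_cumulant_le {μs : ℕ → Prob d} {μ : Prob d} {a p : ℕ → ℝ}
    {c : ℕ → EuclideanSpace ℝ (Fin d)} (hp : ∀ n, 1 ≤ n → 0 < p n)
    {z : EuclideanSpace ℝ (Fin d)}
    (hlim : Tendsto
      (fun n => (∏ j ∈ Finset.Icc 1 n, charPow (μs j) (p n) ((a n)⁻¹ • z))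
        * Complex.exp (Complex.I * ((inner ℝ (c n) z : ℝ) : ℂ)))
      atTop (𝓝 (charFun (μ : Measure (EuclideanSpace ℝ (Fin d))) z)))
    (hne : charFun (μ : Measure (EuclideanSpace ℝ (Fin d))) z ≠ 0) {j : ℕ} (hj : 1 ≤ j)
    {η : ℝ} (hη : 0 < η) :
    ∀ᶠ n in atTop, p n * -(cumulant (μs j) ((a n)⁻¹ • z)).re ≤
      -Real.log ‖charFun (μ : Measure (EuclideanSpace ℝ (Fin d))) z‖ + η := by
  have h0 : 0 < ‖charFun (μ : Measure (EuclideanSpace ℝ (Fin d))) z‖ := norm_pos_iff.2 hne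
  have hlt : Real.exp (Real.log ‖charFun (μ : Measure (EuclideanSpace ℝ (Fin d))) z‖ - η) <
      ‖charFun (μ : Measure (EuclideanSpace ℝ (Fin d))) z‖ := by
    conv_rhs => rw [← Real.exp_log h0]
    exact Real.exp_lt_exp.2 (by linarith)
  filter_upwards [hlim.norm.eventually_const_lt hlt, eventually_ge_atTop j] with n hn hnj
  have hpn := (hp n (hj.trans hnj)).le
  rw [norm_mul, Complex.norm_exp_I_mul_ofReal, mul_one,
    ← Finset.mul_prod_erase _ _ (Finset.mem_Icc.2 ⟨hj, hnj⟩), norm_mul, norm_charPow] at hn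
  have h1 : ‖∏ i ∈ (Finset.Icc 1 n).erase j, charPow (μs i) (p n) ((a n)⁻¹ • z)‖ ≤ 1 := by
    rw [norm_prod]
    exact Finset.prod_le_one (fun _ _ => norm_nonneg _) fun i _ => norm_charPow_le_one _ hpn _
  have h2 := Real.exp_lt_exp.1
    (hn.trans_le (mul_le_of_le_one_right (Real.exp_pos _).le h1))
  linarith

/-- In the limit scheme with limit in `𝒞_α`, the contribution of each single `μ_j` is asymptotically
degenerate. -/
lemma exists_shift_factor_tendsto_one {α : ℝ} (hα : α < 2) {μ : Prob d} (hμ : μ ∈ classC d α)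
    {μs : ℕ → Prob d} {a p : ℕ → ℝ} {c : ℕ → EuclideanSpace ℝ (Fin d)}
    (ha0 : ∀ n, 1 ≤ n → 0 < a n)
    (hmono : MonotoneOn a (Set.Ici 1)) (ha : Tendsto a atTop atTop)
    (hratio : Tendsto (fun n => a (n + 1) / a n) atTop (𝓝 1))
    (hp0 : ∀ n, 1 ≤ n → 0 < p n) (hp : Tendsto (fun n => p n / a n ^ α) atTop (𝓝 1))
    (hlim : ∀ z, Tendsto
      (fun n => (∏ j ∈ Finset.Icc 1 n, charPow (μs j) (p n) ((a n)⁻¹ • z))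
        * Complex.exp (Complex.I * ((inner ℝ (c n) z : ℝ) : ℂ)))
      atTop (𝓝 (charFun (μ : Measure (EuclideanSpace ℝ (Fin d))) z)))
    {j : ℕ} (hj : 1 ≤ j) (hμj : μs j ∈ infDiv d) :
    ∃ b : ℕ → EuclideanSpace ℝ (Fin d), ∀ z,
      Tendsto (fun n => charPow (μs j) (p n) ((a n)⁻¹ • z) *
        Complex.exp (Complex.I * ((inner ℝ (b n) z : ℝ) : ℂ))) atTop (𝓝 1) := by
  obtain ⟨-, A, ν, γ, hT, htail⟩ := hμ
  have hne : ∀ z, charFun (μ : Measure (EuclideanSpace ℝ (Fin d))) z ≠ 0 := fun z => by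
    rw [hT.charFun_eq]
    exact Complex.exp_ne_zero _
  have hG : ∀ z, -Real.log ‖charFun (μ : Measure (EuclideanSpace ℝ (Fin d))) z‖ =
      -(lkExponent A ν γ z).re := fun z => by
    rw [hT.charFun_eq, Complex.norm_exp, Real.log_exp]
  refine exists_shift_charPow_tendsto_one hμj hp0 fun z =>
    tendsto_zero_of_limsup_le (ψ := fun z => -(cumulant (μs j) z).re)
      (G := fun z => -Real.log ‖charFun (μ : Measure (EuclideanSpace ℝ (Fin d))) z‖) (α := α)
      (Complex.continuous_re.comp (continuous_cumulant _)).neg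
      (fun z => neg_nonneg.2 (re_cumulant_nonpos _ z)) (neg_re_cumulant_sub_le hμj)
      (continuous_charFun.norm.log fun z => norm_ne_zero_iff.2 (hne z)).neg (by simp)
      ha0 hmono ha hratio hp0 hp
      (fun z η hη => eventually_mul_neg_re_cumulant_le hp0 (hlim z) (hne z) hj hη)
      (fun z ε hε => ?_) z
  simp only [hG]
  exact exists_rpow_mul_neg_re_lkExponent_le hα hT.finite htail γ z hε

/-- Finitely many members of the sequence can be replaced by the distribution concentrated at the
origin, at the price of a new centering. -/
lemma IsLimitOf.replace_diracZero {α : ℝ} (hα : α < 2) {μ : Prob d} (hμ : μ ∈ classC d α)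
    {μs : ℕ → Prob d} (hμs : ∀ j, 1 ≤ j → μs j ∈ infDiv d) (h : IsLimitOf α μs μ) (j₀ : ℕ) :
    IsLimitOf α (fun j => if j < j₀ then diracZero d else μs j) μ := by
  obtain ⟨a, c, p, ha0, hmono, ha, hratio, hp0, hp, hlim⟩ := h
  have hb : ∀ j, ∃ b : ℕ → EuclideanSpace ℝ (Fin d), 1 ≤ j → ∀ z,
      Tendsto (fun n => charPow (μs j) (p n) ((a n)⁻¹ • z) *
        Complex.exp (Complex.I * ((inner ℝ (b n) z : ℝ) : ℂ))) atTop (𝓝 1) := fun j => by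
    by_cases hj : 1 ≤ j
    · obtain ⟨b, hb⟩ := exists_shift_factor_tendsto_one hα hμ ha0 hmono ha hratio hp0 hp hlim hj
        (hμs j hj)
      exact ⟨b, fun _ => hb⟩
    · exact ⟨0, fun h => absurd h hj⟩
  choose b hb using hb
  refine ⟨a, fun n => c n - ∑ j ∈ Finset.Ico 1 j₀, b j n, p, ha0, hmono, ha, hratio, hp0, hp,
    fun z => ?_⟩
  have hR : Tendsto (fun n => ∏ j ∈ Finset.Ico 1 j₀, (charPow (μs j) (p n) ((a n)⁻¹ • z) *
      Complex.exp (Complex.I * ((inner ℝ (b j n) z : ℝ) : ℂ)))) atTop (𝓝 1) := by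
    simpa using tendsto_finsetProd (Finset.Ico 1 j₀)
      fun j hj => hb j (Finset.mem_Ico.1 hj).1 z
  have hdiv := (hlim z).div hR one_ne_zero
  rw [div_one] at hdiv
  refine hdiv.congr' ?_
  filter_upwards [eventually_ge_atTop j₀] with n hn
  have hR0 : ∏ j ∈ Finset.Ico 1 j₀, (charPow (μs j) (p n) ((a n)⁻¹ • z) *
      Complex.exp (Complex.I * ((inner ℝ (b j n) z : ℝ) : ℂ))) ≠ 0 :=
    Finset.prod_ne_zero_iff.2 fun j _ =>
      mul_ne_zero (Complex.exp_ne_zero _) (Complex.exp_ne_zero _)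
  have hfilter : (Finset.Icc 1 n).filter (· < j₀) = Finset.Ico 1 j₀ := by
    ext j
    simp only [Finset.mem_filter, Finset.mem_Icc, Finset.mem_Ico]
    omega
  have hsplit : ∏ j ∈ Finset.Icc 1 n, charPow (μs j) (p n) ((a n)⁻¹ • z) =
      (∏ j ∈ Finset.Ico 1 j₀, charPow (μs j) (p n) ((a n)⁻¹ • z)) *
        ∏ j ∈ Finset.Icc 1 n,
          charPow (if j < j₀ then diracZero d else μs j) (p n) ((a n)⁻¹ • z) := by
    rw [← hfilter, Finset.prod_filter, ← Finset.prod_mul_distrib]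
    refine Finset.prod_congr rfl fun j _ => ?_
    split_ifs with hj
    · rw [charPow_diracZero, mul_one]
    · rw [one_mul]
  have hcenter : Complex.exp (Complex.I * ((inner ℝ (c n) z : ℝ) : ℂ)) =
      (∏ j ∈ Finset.Ico 1 j₀, Complex.exp (Complex.I * ((inner ℝ (b j n) z : ℝ) : ℂ))) *
        Complex.exp
          (Complex.I * ((inner ℝ (c n - ∑ j ∈ Finset.Ico 1 j₀, b j n) z : ℝ) : ℂ)) := by
    rw [← Complex.exp_sum, ← Complex.exp_add, inner_sub_left, sum_inner, ← Finset.mul_sum]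
    push_cast
    ring_nf
  simp only [Pi.div_apply]
  rw [div_eq_iff hR0, hsplit, hcenter, Finset.prod_mul_distrib]
  ring

end AlphaSD

theorem theorem3p4 {d : ℕ} (α : ℝ) (hα : α < 2) (H : Set (AlphaSD.Prob d))
    (hH : AlphaSD.IsCCSS H) (μ : AlphaSD.Prob d) (hμ : μ ∈ AlphaSD.classC d α) :
    μ ∈ AlphaSD.classQ α H ↔
      ∃ μs : ℕ → AlphaSD.Prob d, (∀ j, 1 ≤ j → μs j ∈ H) ∧ AlphaSD.IsLimitOf α μs μ := by
  constructor
  · rintro ⟨μs, hμs, ⟨j₀, -, hH₀⟩, hlim⟩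
    refine ⟨_, fun j _ => ?_, hlim.replace_diracZero hα hμ hμs j₀⟩
    split_ifs with h
    · exact hH.diracZero_mem (hH₀ j₀ le_rfl)
    · exact hH₀ j (not_lt.1 h)
  · rintro ⟨μs, hμs, hlim⟩
    exact ⟨μs, fun j hj => hH.subset_infDiv (hμs j hj), ⟨1, le_rfl, hμs⟩, hlim⟩
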